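/- Let $n,k\ge 1$ be integers, $\varepsilon>0$, and let $z_1,\dots,z_k$ be i.i.d. $\mathcal N(0,\mathbf I_n)$ random vectors. Let $\mathbf S_n$ be the space of real symmetric $n\times n$ matrices with inner product $\langle A,B\rangle=\mathbf{Tr}(A^TB)$ and Frobenius norm $\|\cdot\|_F$, write $\lambda_{\max}$ for the largest eigenvalue, and set $$\mathsf F_k(X)=\mathbf E\Big[\max_{1\le i\le k}\lambda_{\max}\big(X+\tfrac{\varepsilon}{n}z_iz_i^T\big)\Big],\qquad X\in\mathbf S_n.$$ Fix $X\in\mathbf S_n$, let $i_0$ (random) be an index attaining $\max_{1\le i\le k}\lambda_{\max}(X+\frac{\varepsilon}{n}z_iz_i^T)$, and let $\phi_{i_0}$ be a unit leading eigenvector of $X+\frac{\varepsilon}{n}z_{i_0}z_{i_0}^T$. Then almost surely $i_0$ is unique and $\phi_{i_0}$ is unique up to sign. The function $\mathsf F_k$ is finite (the random variable inside the expectation is integrable at every point of $\mathbf S_n$) and is differentiable at $X$, the random matrix $\phi_{i_0}\phi_{i_0}^T$ is integrable, and $$\nabla\mathsf F_k(X)=\mathbf E\big[\phi_{i_0}\phi_{i_0}^T\big],\qquad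 \mathbf{Tr}\big(\nabla\mathsf F_k(X)\big)=1.$$ Moreover $\|\phi_{i_0}\phi_{i_0}^T-\nabla\mathsf F_k(X)\|_F^2$ is integrable and $$\mathbf E\Big[\big\|\phi_{i_0}\phi_{i_0}^T-\nabla\mathsf F_k(X)\big\|_F^2\Big]=1-\mathbf{Tr}\big(\nabla\mathsf F_k(X)^2\big)\le 1.$$ -/

import Mathlib

open MeasureTheory ProbabilityTheory

open scoped Matrix Gradient

/-- The space of real symmetric `n × n` matrices, as a subspace of all matrices. -/
def symSubmodule (n : ℕ) : Submodule ℝ (Matrix (Fin n) (Fin n) ℝ) where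
  carrier := {A | A.IsSymm}
  add_mem' hA hB := Matrix.IsSymm.add hA hB
  zero_mem' := Matrix.isSymm_zero
  smul_mem' c _ hA := Matrix.IsSymm.smul hA c

/-- The real vector space of real symmetric `n × n` matrices; it is equipped below with the
trace inner product, whose norm is the Frobenius norm. -/
def SymMat (n : ℕ) : Type := symSubmodule n

namespace SymMat

noncomputable instance (n : ℕ) : AddCommGroup (SymMat n) :=
  inferInstanceAs (AddCommGroup (symSubmodule n))

noncomputable instance (n : ℕ) : Module ℝ (SymMat n) :=
  inferInstanceAs (Module ℝ (symSubmodule n))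

instance (n : ℕ) : FiniteDimensional ℝ (SymMat n) :=
  inferInstanceAs (FiniteDimensional ℝ (symSubmodule n))

/-- The underlying matrix. -/
def mat {n : ℕ} (A : SymMat n) : Matrix (Fin n) (Fin n) ℝ := A.1

theorem mat_isSymm {n : ℕ} (A : SymMat n) : A.mat.IsSymm := A.2

theorem mat_injective {n : ℕ} : Function.Injective (mat (n := n)) := Subtype.val_injective

@[simp] theorem mat_add {n : ℕ} (A B : SymMat n) : (A + B).mat = A.mat + B.mat := rfl

@[simp] theorem mat_sub {n : ℕ} (A B : SymMat n) : (A - B).mat = A.mat - B.mat := rfl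

@[simp] theorem mat_smul {n : ℕ} (c : ℝ) (A : SymMat n) : (c • A).mat = c • A.mat := rfl

@[simp] theorem mat_zero {n : ℕ} : (0 : SymMat n).mat = 0 := rfl

/-- The trace inner product `⟨A, B⟩ = Tr(Aᵀ B)` on symmetric matrices. -/
@[reducible] noncomputable def innerCore (n : ℕ) : InnerProductSpace.Core ℝ (SymMat n) where
  inner A B := (A.matᵀ * B.mat).trace
  conj_inner_symm A B := by
    change (B.matᵀ * A.mat).trace = (A.matᵀ * B.mat).trace
    rw [← Matrix.trace_transpose, Matrix.transpose_mul, Matrix.transpose_transpose]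
  re_inner_nonneg A := by
    change 0 ≤ (A.matᵀ * A.mat).trace
    simp only [Matrix.trace, Matrix.diag, Matrix.mul_apply, Matrix.transpose_apply]
    exact Finset.sum_nonneg fun i _ => Finset.sum_nonneg fun j _ => mul_self_nonneg _
  add_left A B C := by
    change ((A + B).matᵀ * C.mat).trace = (A.matᵀ * C.mat).trace + (B.matᵀ * C.mat).trace
    rw [mat_add, Matrix.transpose_add, Matrix.add_mul, Matrix.trace_add]
  smul_left A B r := by
    change ((r • A).matᵀ * B.mat).trace = r * (A.matᵀ * B.mat).trace
    rw [mat_smul, Matrix.transpose_smul, Matrix.smul_mul, Matrix.trace_smul, smul_eq_mul]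
  definite A h := by
    apply mat_injective
    rw [mat_zero]
    change (A.matᵀ * A.mat).trace = 0 at h
    exact (Matrix.trace_conjTranspose_mul_self_eq_zero_iff (A := A.mat)).1
      (by rwa [Matrix.conjTranspose_eq_transpose_of_trivial])

noncomputable instance (n : ℕ) : NormedAddCommGroup (SymMat n) :=
  (innerCore n).toNormedAddCommGroup

noncomputable instance (n : ℕ) : InnerProductSpace ℝ (SymMat n) :=
  InnerProductSpace.ofCore (innerCore n).toCore

instance (n : ℕ) : CompleteSpace (SymMat n) := FiniteDimensional.complete ℝ (SymMat n)

theorem inner_eq_trace {n : ℕ} (A B : SymMat n) : inner ℝ A B = (A.matᵀ * B.mat).trace := rfl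

/-- The norm on `SymMat n` is the Frobenius norm. -/
theorem norm_sq_eq_sum {n : ℕ} (A : SymMat n) : ‖A‖ ^ 2 = ∑ i, ∑ j, A.mat i j ^ 2 := by
  rw [← real_inner_self_eq_norm_sq, inner_eq_trace, Finset.sum_comm]
  simp [Matrix.trace, Matrix.mul_apply, sq]

/-- The rank one symmetric matrix `v vᵀ`. -/
def outer {n : ℕ} (v : EuclideanSpace ℝ (Fin n)) : SymMat n :=
  ⟨Matrix.vecMulVec (WithLp.ofLp v) (WithLp.ofLp v), by
    change (Matrix.vecMulVec (WithLp.ofLp v) (WithLp.ofLp v))ᵀ = _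
    exact Matrix.transpose_vecMulVec _ _⟩

/-- The largest eigenvalue of a symmetric matrix (for `n ≥ 1` the set of real eigenvalues is
finite and non-empty, so that the supremum is a maximum). -/
noncomputable def lambdaMax {n : ℕ} (A : SymMat n) : ℝ := sSup (spectrum ℝ A.mat)

/-- `φ` is a (unit) leading eigenvector of `A`. -/
def IsLeadingEigenvector {n : ℕ} (A : SymMat n) (φ : EuclideanSpace ℝ (Fin n)) : Prop :=
  ‖φ‖ = 1 ∧ A.mat *ᵥ WithLp.ofLp φ = A.lambdaMax • WithLp.ofLp φ

/-- The rank one perturbation `X + (ε / n) v vᵀ`. -/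
noncomputable def perturb {n : ℕ} (ε : ℝ) (X : SymMat n) (v : EuclideanSpace ℝ (Fin n)) :
    SymMat n :=
  X + (ε / n) • outer v

/-- The value `max_{i} λ_max (X + (ε / n) vᵢ vᵢᵀ)`, the maximum being over `i = 1, …, k`. -/
noncomputable def maxPerturbed {n k : ℕ} (ε : ℝ) (v : Fin k → EuclideanSpace ℝ (Fin n))
    (X : SymMat n) : ℝ :=
  ⨆ i, (perturb ε X (v i)).lambdaMax

/-- The smoothed function `X ↦ E [max_{i} λ_max (X + (ε / n) zᵢ zᵢᵀ)]`. -/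
noncomputable def smoothed {n k : ℕ} {Ω : Type*} [MeasurableSpace Ω] (P : Measure Ω) (ε : ℝ)
    (z : Fin k → Ω → EuclideanSpace ℝ (Fin n)) (X : SymMat n) : ℝ :=
  ∫ ω, maxPerturbed ε (fun i => z i ω) X ∂P

end SymMat

/-! By the Rayleigh principle, `maxPerturbed ε v X` is the maximum of `⟨u uᵀ, X⟩ + (ε / n) ⟨u, vᵢ⟩ ^
2` over indices `i` and unit vectors `u`: affine functions of `X` with slope `u uᵀ`, over a compact
set. By Danskin's theorem it is differentiable at `X` as soon as all maximizers share one slope, and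
the gradient is that slope.

Two almost sure facts give this. The leading eigenvector is unique up to sign: a Gaussian `v` is not
orthogonal to a fixed leading eigenvector of `X`, so the perturbation raises `λ_max`, and then the
new top eigenvalue is simple (`IsLeadingEigenvector.eq_or_eq_neg`). The index is unique: `v ↦ λ_max
(X + (ε / n) v vᵀ)` is convex, its level sets are null (`stdGaussian_lambdaMax_perturb_eq`), and
independence with Fubini excludes ties.

Since `maxPerturbed` is 1-Lipschitz in `X`, the gradient passes under the expectation. The trace and
variance formulas follow from `φ φᵀ` having trace and Frobenius norm 1. -/

/-! ### Danskin's theorem and absolute continuity of the Gaussian measure. -/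

/-- **Danskin's theorem** for a maximum of a compact family of affine functions: if all maximizers
at `x₀` have the same slope `p`, then the maximum is differentiable at `x₀` with gradient `p`. -/
theorem hasGradientAt_of_affine_max {E K : Type*} [NormedAddCommGroup E] [InnerProductSpace ℝ E]
    [CompleteSpace E] [TopologicalSpace K] [CompactSpace K] {a : K → E} {b : K → ℝ} {g : E → ℝ}
    {x₀ p : E} (ha : Continuous a) (hb : Continuous b)
    (hle : ∀ y x, inner ℝ (a x) y + b x ≤ g y)
    (hatt : ∀ y, ∃ x, g y = inner ℝ (a x) y + b x)
    (huniq : ∀ x, inner ℝ (a x) x₀ + b x = g x₀ → a x = p) :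
    HasGradientAt g p x₀ := by
  obtain ⟨x₁, hx₁⟩ := hatt x₀
  have hp : a x₁ = p := huniq x₁ hx₁.symm
  obtain ⟨M, hM⟩ := isCompact_univ.exists_bound_of_continuousOn ha.continuousOn
  have hM' : ∀ x, ‖a x‖ ≤ M := fun x => hM x (Set.mem_univ x)
  have hpM : ‖p‖ ≤ M := hp ▸ hM' x₁
  have hM0 : 0 ≤ M := (norm_nonneg p).trans hpM
  have hlow : ∀ y, g x₀ + inner ℝ p (y - x₀) ≤ g y := fun y => by
    have := hle y x₁
    rw [hp] at this hx₁
    rw [inner_sub_right]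
    linarith
  rw [hasGradientAt_iff_isLittleO, Asymptotics.isLittleO_iff]
  intro c hc
  -- Slopes at distance at least `c` from `p` form a compact set of parameters containing no
  -- maximizer at `x₀`, so their values there stay below `g x₀` by a fixed gap.
  obtain ⟨δ, hδ, hgap⟩ : ∃ δ > 0, ∀ x, c ≤ ‖a x - p‖ → inner ℝ (a x) x₀ + b x ≤ g x₀ - δ := by
    have hcpt : IsCompact {x | c ≤ ‖a x - p‖} :=
      (isClosed_le continuous_const (by fun_prop)).isCompact
    rcases Set.eq_empty_or_nonempty {x | c ≤ ‖a x - p‖} with he | hne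
    · exact ⟨1, one_pos, fun x hx => absurd (show x ∈ {x | c ≤ ‖a x - p‖} from hx) (by simp [he])⟩
    · obtain ⟨x₂, hx₂, hmax⟩ := hcpt.exists_isMaxOn hne
        (f := fun x => inner ℝ (a x) x₀ + b x) (by fun_prop)
      refine ⟨g x₀ - (inner ℝ (a x₂) x₀ + b x₂), ?_, fun x hx => ?_⟩
      · rw [gt_iff_lt, sub_pos]
        refine lt_of_le_of_ne (hle x₀ x₂) fun h => ?_
        have h0 : a x₂ - p = 0 := sub_eq_zero.2 (huniq x₂ h)
        have h1 : c ≤ ‖a x₂ - p‖ := hx₂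
        rw [h0, norm_zero] at h1
        linarith
      · have : inner ℝ (a x) x₀ + b x ≤ inner ℝ (a x₂) x₀ + b x₂ := hmax hx
        linarith
  -- Moving from `x₀` to `y` costs at most `M * ‖y - x₀‖` for each of the slopes `a x` and `p`, so
  -- on this ball the gap survives. The `+ 1` keeps the denominator positive.
  have hr : 0 < δ / (2 * M + 1) := by positivity
  filter_upwards [Metric.ball_mem_nhds x₀ hr] with y hy
  rw [Metric.mem_ball, dist_eq_norm, lt_div_iff₀ (by positivity)] at hy
  obtain ⟨x, hx⟩ := hatt y
  have hsplit : inner ℝ (a x) y = inner ℝ (a x) x₀ + inner ℝ (a x) (y - x₀) := by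
    rw [inner_sub_right]; ring
  have h1 : inner ℝ (a x) (y - x₀) ≤ M * ‖y - x₀‖ :=
    (real_inner_le_norm _ _).trans (by gcongr; exact hM' x)
  have h2 : -(M * ‖y - x₀‖) ≤ inner ℝ p (y - x₀) := by
    have := (abs_real_inner_le_norm p (y - x₀)).trans
      (mul_le_mul_of_nonneg_right hpM (norm_nonneg (y - x₀)))
    exact (abs_le.1 this).1
  have hclose : ‖a x - p‖ ≤ c := by
    by_contra! hcon
    have := hgap x hcon.le
    have := hlow y
    nlinarith [norm_nonneg (y - x₀)]
  have h3 : inner ℝ (a x - p) (y - x₀) ≤ c * ‖y - x₀‖ :=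
    (real_inner_le_norm _ _).trans (by gcongr)
  rw [inner_sub_left] at h3
  -- The remainder is nonnegative by `hlow`, and at most `⟨a x - p, y - x₀⟩` because `x` is
  -- admissible at `x₀`.
  rw [Real.norm_eq_abs, abs_of_nonneg (by linarith [hlow y])]
  have := hle x₀ x
  linarith

/-- A product of absolutely continuous measures on a finite power is absolutely continuous. -/
theorem absolutelyContinuous_pi_fin {n : ℕ} {μ ν : Measure ℝ} [SigmaFinite μ] [SigmaFinite ν]
    (h : μ ≪ ν) : Measure.pi (fun _ : Fin n => μ) ≪ Measure.pi (fun _ : Fin n => ν) := by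
  induction n with
  | zero => rw [Measure.pi_of_empty, Measure.pi_of_empty]
  | succ n ih =>
    have hμ := (measurePreserving_piFinSuccAbove (fun _ : Fin (n + 1) => μ) 0).symm
    have hν := (measurePreserving_piFinSuccAbove (fun _ : Fin (n + 1) => ν) 0).symm
    rw [← hμ.map_eq, ← hν.map_eq]
    exact (h.prod ih).map hμ.measurable

theorem stdGaussian_absolutelyContinuous (n : ℕ) :
    stdGaussian (EuclideanSpace ℝ (Fin n)) ≪ volume := by
  rw [← map_pi_eq_stdGaussian, ← (PiLp.volume_preserving_toLp (Fin n)).map_eq]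
  exact (absolutelyContinuous_pi_fin (gaussianReal_absolutelyContinuous 0 one_ne_zero)).map
    (PiLp.volume_preserving_toLp (Fin n)).measurable

/-! ### Rank one matrices and the Rayleigh principle. -/

namespace SymMat

variable {n k : ℕ}

theorem outer_neg (v : EuclideanSpace ℝ (Fin n)) : outer (-v) = outer v := by
  apply mat_injective
  simp [mat, outer, Matrix.neg_vecMulVec, Matrix.vecMulVec_neg]

theorem inner_outer_left (v : EuclideanSpace ℝ (Fin n)) (A : SymMat n) :
    inner ℝ (outer v) A = WithLp.ofLp v ⬝ᵥ A.mat *ᵥ WithLp.ofLp v := by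
  change ((Matrix.vecMulVec (WithLp.ofLp v) (WithLp.ofLp v))ᵀ * A.mat).trace = _
  rw [Matrix.transpose_vecMulVec, Matrix.trace_mul_comm, Matrix.mul_vecMulVec,
    Matrix.trace_vecMulVec, dotProduct_comm]

theorem inner_outer_outer (u v : EuclideanSpace ℝ (Fin n)) :
    inner ℝ (outer u) (outer v) = inner ℝ u v ^ 2 := by
  rw [inner_outer_left]
  change WithLp.ofLp u ⬝ᵥ Matrix.vecMulVec (WithLp.ofLp v) (WithLp.ofLp v) *ᵥ WithLp.ofLp u = _
  rw [Matrix.vecMulVec_mulVec, EuclideanSpace.inner_eq_star_dotProduct]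
  simp [dotProduct_comm, sq]

theorem norm_outer (v : EuclideanSpace ℝ (Fin n)) : ‖outer v‖ = ‖v‖ ^ 2 := by
  rw [← sq_eq_sq₀ (norm_nonneg _) (by positivity), ← real_inner_self_eq_norm_sq,
    inner_outer_outer, real_inner_self_eq_norm_sq]

/-- The topology comes from the trace inner product, so continuity is read off `‖u uᵀ - v vᵀ‖ ^ 2 =
‖u‖ ^ 4 - 2 ⟨u, v⟩ ^ 2 + ‖v‖ ^ 4`. -/
theorem continuous_outer : Continuous (outer : EuclideanSpace ℝ (Fin n) → SymMat n) := by
  rw [continuous_iff_continuousAt]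
  intro v
  rw [ContinuousAt, tendsto_iff_norm_sub_tendsto_zero]
  have h : ∀ u : EuclideanSpace ℝ (Fin n), ‖outer u - outer v‖
      = Real.sqrt ((‖u‖ ^ 2) ^ 2 - 2 * inner ℝ u v ^ 2 + (‖v‖ ^ 2) ^ 2) := fun u => by
    rw [← Real.sqrt_sq (norm_nonneg (outer u - outer v)), norm_sub_sq_real, norm_outer, norm_outer,
      inner_outer_outer]
  simp_rw [h]
  have hc : Continuous fun u : EuclideanSpace ℝ (Fin n) =>
      Real.sqrt ((‖u‖ ^ 2) ^ 2 - 2 * inner ℝ u v ^ 2 + (‖v‖ ^ 2) ^ 2) := by fun_prop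
  convert hc.tendsto v using 2
  rw [real_inner_self_eq_norm_sq]
  ring_nf
  simp

theorem mat_isHermitian (A : SymMat n) : A.mat.IsHermitian := by
  rw [Matrix.IsHermitian, Matrix.conjTranspose_eq_transpose_of_trivial]
  exact A.mat_isSymm

theorem le_lambdaMax_of_mem_spectrum (A : SymMat n) {t : ℝ} (ht : t ∈ spectrum ℝ A.mat) :
    t ≤ A.lambdaMax :=
  le_csSup (Matrix.finite_real_spectrum (A := A.mat)).bddAbove ht

theorem posSemidef_lambdaMax_sub (A : SymMat n) :
    (algebraMap ℝ (Matrix (Fin n) (Fin n) ℝ) A.lambdaMax - A.mat).PosSemidef := by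
  have hH : (algebraMap ℝ (Matrix (Fin n) (Fin n) ℝ) A.lambdaMax - A.mat).IsHermitian := by
    refine Matrix.IsHermitian.sub ?_ A.mat_isHermitian
    rw [Matrix.algebraMap_eq_diagonal]
    exact Matrix.isHermitian_diagonal _
  rw [hH.posSemidef_iff_eigenvalues_nonneg]
  intro i
  have hi := hH.eigenvalues_mem_spectrum_real i
  rw [← spectrum.singleton_sub_eq, Set.singleton_sub] at hi
  obtain ⟨t, ht, hti⟩ := hi
  change 0 ≤ hH.eigenvalues i
  rw [← hti]
  exact sub_nonneg.2 (A.le_lambdaMax_of_mem_spectrum ht)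

theorem dotProduct_lambdaMax_sub (A : SymMat n) (v : EuclideanSpace ℝ (Fin n)) :
    star (WithLp.ofLp v) ⬝ᵥ (algebraMap ℝ (Matrix (Fin n) (Fin n) ℝ) A.lambdaMax - A.mat) *ᵥ
      WithLp.ofLp v = A.lambdaMax * ‖v‖ ^ 2 - inner ℝ (outer v) A := by
  rw [inner_outer_left, Matrix.sub_mulVec, dotProduct_sub, star_trivial,
    Algebra.algebraMap_eq_smul_one, Matrix.smul_mulVec, Matrix.one_mulVec, dotProduct_smul,
    EuclideanSpace.real_norm_sq_eq]
  simp [dotProduct, sq]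

theorem inner_outer_le (A : SymMat n) (v : EuclideanSpace ℝ (Fin n)) :
    inner ℝ (outer v) A ≤ A.lambdaMax * ‖v‖ ^ 2 := by
  have := A.posSemidef_lambdaMax_sub.dotProduct_mulVec_nonneg (WithLp.ofLp v)
  rw [dotProduct_lambdaMax_sub] at this
  linarith

theorem inner_outer_of_mulVec {A : SymMat n} {v : EuclideanSpace ℝ (Fin n)} {t : ℝ}
    (h : A.mat *ᵥ WithLp.ofLp v = t • WithLp.ofLp v) : inner ℝ (outer v) A = t * ‖v‖ ^ 2 := by
  rw [inner_outer_left, h, dotProduct_smul, EuclideanSpace.real_norm_sq_eq]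
  simp [dotProduct, sq]

/-- The equality case of the Rayleigh bound: a positive semidefinite matrix kills every vector on
which its quadratic form vanishes. This identifies leading eigenvectors with maximizers. -/
theorem isLeadingEigenvector_iff {A : SymMat n} {v : EuclideanSpace ℝ (Fin n)} :
    A.IsLeadingEigenvector v ↔ ‖v‖ = 1 ∧ inner ℝ (outer v) A = A.lambdaMax := by
  refine and_congr_right fun hv => ⟨fun h => ?_, fun h => ?_⟩
  · rw [inner_outer_of_mulVec h, hv]; ring
  · have := (A.posSemidef_lambdaMax_sub.dotProduct_mulVec_zero_iff (WithLp.ofLp v)).1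
      (by rw [dotProduct_lambdaMax_sub, hv, h]; ring)
    rw [Matrix.sub_mulVec, sub_eq_zero, Algebra.algebraMap_eq_smul_one, Matrix.smul_mulVec,
      Matrix.one_mulVec] at this
    exact this.symm

theorem exists_isLeadingEigenvector (hn : 1 ≤ n) (A : SymMat n) :
    ∃ v, A.IsLeadingEigenvector v := by
  have : Nonempty (Fin n) := ⟨⟨0, hn⟩⟩
  have hmem : A.lambdaMax ∈ spectrum ℝ A.mat :=
    Set.Nonempty.csSup_mem
      ⟨_, A.mat_isHermitian.eigenvalues_mem_spectrum_real (Classical.arbitrary _)⟩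
      (Matrix.finite_real_spectrum (A := A.mat))
  rw [A.mat_isHermitian.spectrum_real_eq_range_eigenvalues] at hmem
  obtain ⟨i, hi⟩ := hmem
  refine ⟨A.mat_isHermitian.eigenvectorBasis i, A.mat_isHermitian.eigenvectorBasis.norm_eq_one i, ?_⟩
  rw [← hi]
  exact A.mat_isHermitian.mulVec_eigenvectorBasis i

/-! ### Rank one perturbations: simplicity, convexity and null level sets. -/

theorem inner_outer_perturb (ε : ℝ) (X : SymMat n) (u v : EuclideanSpace ℝ (Fin n)) :
    inner ℝ (outer u) (perturb ε X v) = inner ℝ (outer u) X + ε / n * inner ℝ u v ^ 2 := by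
  rw [perturb, inner_add_right, inner_smul_right, inner_outer_outer]

theorem lipschitzWith_lambdaMax (hn : 1 ≤ n) :
    LipschitzWith 1 (lambdaMax : SymMat n → ℝ) := by
  refine LipschitzWith.of_le_add fun A B => ?_
  obtain ⟨v, hv⟩ := A.exists_isLeadingEigenvector hn
  obtain ⟨hv1, hvA⟩ := isLeadingEigenvector_iff.1 hv
  have h1 := B.inner_outer_le v
  have h2 := real_inner_le_norm (outer v) (A - B)
  rw [norm_outer, hv1, inner_sub_right] at h2
  rw [hv1] at h1
  rw [dist_eq_norm]
  linarith

theorem lambdaMax_lt_perturb {ε : ℝ} (hn : 1 ≤ n) (hε : 0 < ε) {X : SymMat n}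
    {u v : EuclideanSpace ℝ (Fin n)} (hu : X.IsLeadingEigenvector u) (huv : inner ℝ u v ≠ 0) :
    X.lambdaMax < (perturb ε X v).lambdaMax := by
  obtain ⟨hu1, huX⟩ := isLeadingEigenvector_iff.1 hu
  have h := (perturb ε X v).inner_outer_le u
  rw [inner_outer_perturb, hu1, huX] at h
  have : 0 < ε / n * inner ℝ u v ^ 2 := by
    have : (0 : ℝ) < n := by exact_mod_cast hn
    positivity
  linarith

/-- If a rank one perturbation raises the largest eigenvalue, the new largest eigenvalue is
simple. -/
theorem IsLeadingEigenvector.eq_or_eq_neg {ε : ℝ} {X : SymMat n}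
    {v φ ψ : EuclideanSpace ℝ (Fin n)} (hv : X.lambdaMax < (perturb ε X v).lambdaMax)
    (hφ : (perturb ε X v).IsLeadingEigenvector φ) (hψ : (perturb ε X v).IsLeadingEigenvector ψ) :
    ψ = φ ∨ ψ = -φ := by
  -- The quadratic form at a vector orthogonal to `v` does not see the perturbation, so it cannot
  -- exceed `X.lambdaMax * ‖w‖ ^ 2`.
  have horth : ∀ w : EuclideanSpace ℝ (Fin n), inner ℝ w v = 0 →
      (perturb ε X v).mat *ᵥ WithLp.ofLp w = (perturb ε X v).lambdaMax • WithLp.ofLp w →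
      w = 0 := by
    intro w hw hA
    have h1 := inner_outer_of_mulVec hA
    rw [inner_outer_perturb, hw] at h1
    have h2 := X.inner_outer_le w
    by_contra hne
    have : 0 < ‖w‖ ^ 2 := by positivity
    nlinarith
  have hφv : inner ℝ φ v ≠ 0 := fun h => by
    have := hφ.1
    rw [horth φ h hφ.2, norm_zero] at this
    exact zero_ne_one this
  -- This combination stays in the top eigenspace and is orthogonal to `v`.
  have hw : inner ℝ ψ v • φ - inner ℝ φ v • ψ = 0 := by
    apply horth
    · rw [inner_sub_left, real_inner_smul_left, real_inner_smul_left]; ring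
    · rw [WithLp.ofLp_sub, WithLp.ofLp_smul, WithLp.ofLp_smul, Matrix.mulVec_sub,
        Matrix.mulVec_smul, Matrix.mulVec_smul, hφ.2, hψ.2, smul_sub, smul_comm,
        smul_comm (inner ℝ φ v)]
  rw [sub_eq_zero] at hw
  have habs : |inner ℝ ψ v| = |inner ℝ φ v| := by
    have := congrArg norm hw
    rwa [norm_smul, norm_smul, hφ.1, hψ.1, mul_one, mul_one, Real.norm_eq_abs,
      Real.norm_eq_abs] at this
  rcases abs_eq_abs.1 habs with h | h
  · left
    rw [h] at hw
    exact (smul_right_injective _ hφv hw).symm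
  · right
    rw [h, neg_smul, ← smul_neg] at hw
    exact (smul_right_injective _ hφv hw).symm

/-- For fixed unit `u` the Rayleigh form is a constant plus a nonnegative multiple of `⟨u, v⟩ ^ 2`,
hence convex in `v`; a maximum of convex functions is convex. -/
theorem convexOn_lambdaMax_perturb {ε : ℝ} (hn : 1 ≤ n) (hε : 0 < ε) (X : SymMat n) :
    ConvexOn ℝ Set.univ fun v => (perturb ε X v).lambdaMax := by
  refine ⟨convex_univ, fun x _ y _ s t hs ht hst => ?_⟩
  obtain ⟨u, hu⟩ := (perturb ε X (s • x + t • y)).exists_isLeadingEigenvector hn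
  obtain ⟨hu1, hu2⟩ := isLeadingEigenvector_iff.1 hu
  have hx := (perturb ε X x).inner_outer_le u
  have hy := (perturb ε X y).inner_outer_le u
  rw [inner_outer_perturb, hu1] at hx hy
  rw [inner_outer_perturb, inner_add_right, real_inner_smul_right, real_inner_smul_right] at hu2
  have hc : 0 ≤ ε / n := by positivity
  have hsq := ((even_two).convexOn_pow (𝕜 := ℝ)).2 (Set.mem_univ (inner ℝ u x))
    (Set.mem_univ (inner ℝ u y)) hs ht hst
  simp only [smul_eq_mul] at hsq ⊢
  have h1 := mul_le_mul_of_nonneg_left hsq hc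
  have h2 := mul_le_mul_of_nonneg_left hx hs
  have h3 := mul_le_mul_of_nonneg_left hy ht
  have h4 : inner ℝ (outer u) X = s * inner ℝ (outer u) X + t * inner ℝ (outer u) X := by
    rw [← add_mul, hst, one_mul]
  linarith

theorem continuous_perturb (ε : ℝ) :
    Continuous fun p : SymMat n × EuclideanSpace ℝ (Fin n) => perturb ε p.1 p.2 :=
  continuous_fst.add ((continuous_outer.comp continuous_snd).const_smul (ε / n : ℝ))

theorem continuous_lambdaMax_perturb (hn : 1 ≤ n) (ε : ℝ) (X : SymMat n) :
    Continuous fun v => (perturb ε X v).lambdaMax :=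
  (lipschitzWith_lambdaMax hn).continuous.comp
    ((continuous_perturb ε).comp (continuous_const.prodMk continuous_id))

theorem perturb_zero_right (ε : ℝ) (X : SymMat n) : perturb ε X 0 = X := by
  have : outer (0 : EuclideanSpace ℝ (Fin n)) = 0 := by
    rw [← norm_eq_zero, norm_outer]; simp
  rw [perturb, this, smul_zero, add_zero]

/-- Almost surely a Gaussian rank one perturbation raises the largest eigenvalue. -/
theorem ae_lambdaMax_lt_perturb {ε : ℝ} (hn : 1 ≤ n) (hε : 0 < ε) (X : SymMat n) :
    ∀ᵐ v ∂stdGaussian (EuclideanSpace ℝ (Fin n)), X.lambdaMax < (perturb ε X v).lambdaMax := by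
  refine (stdGaussian_absolutelyContinuous n).ae_le ?_
  obtain ⟨u, hu⟩ := X.exists_isLeadingEigenvector hn
  have hne : LinearMap.ker (innerₛₗ ℝ u) ≠ ⊤ := fun h => by
    have h2 : u ∈ LinearMap.ker (innerₛₗ ℝ u) := h ▸ Submodule.mem_top
    rw [LinearMap.mem_ker, innerₛₗ_apply_apply, inner_self_eq_zero] at h2
    have := hu.1
    rw [h2, norm_zero] at this
    exact zero_ne_one this
  have h0 := Measure.addHaar_submodule (volume : Measure (EuclideanSpace ℝ (Fin n))) _ hne
  filter_upwards [measure_eq_zero_iff_ae_notMem.1 h0] with v hv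
  exact lambdaMax_lt_perturb hn hε hu fun h => hv (by simpa using h)

/-- The level sets of `v ↦ λ_max (X + (ε / n) v vᵀ)` are Gaussian null sets. -/
theorem stdGaussian_lambdaMax_perturb_eq {ε : ℝ} (hn : 1 ≤ n) (hε : 0 < ε) (X : SymMat n) (t : ℝ) :
    stdGaussian (EuclideanSpace ℝ (Fin n)) {v | (perturb ε X v).lambdaMax = t} = 0 := by
  rcases le_or_gt t X.lambdaMax with ht | ht
  · rw [measure_eq_zero_iff_ae_notMem]
    filter_upwards [ae_lambdaMax_lt_perturb hn hε X] with v hv h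
    have h' : (perturb ε X v).lambdaMax = t := h
    linarith
  -- Above `X.lambdaMax`, the value at `v = 0`, the level set lies in the frontier of a convex
  -- sublevel set, which is Lebesgue null.
  · have hconv := convexOn_lambdaMax_perturb hn hε X
    have hC : Convex ℝ {v | (perturb ε X v).lambdaMax ≤ t} := by
      simpa using hconv.convex_le t
    refine stdGaussian_absolutelyContinuous n
      (measure_mono_null (fun v hv => ?_) (hC.addHaar_frontier volume))
    have hv' : (perturb ε X v).lambdaMax = t := hv
    refine ⟨subset_closure hv'.le, fun hint => ?_⟩
    have hlim : Filter.Tendsto (fun s : ℝ => (1 + s) • v) (nhdsWithin 0 (Set.Ioi 0)) (nhds v) := by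
      have : Continuous fun s : ℝ => (1 + s) • v := by fun_prop
      simpa using (this.tendsto 0).mono_left nhdsWithin_le_nhds
    obtain ⟨s, hs, hs0⟩ := ((hlim.eventually (isOpen_interior.mem_nhds hint)).and
      self_mem_nhdsWithin).exists
    have hs1 : (1 + s) • v ∈ {v | (perturb ε X v).lambdaMax ≤ t} := interior_subset hs
    rw [Set.mem_ofPred_eq] at hs1
    have hs0' : (0 : ℝ) < s := hs0
    have hpos : 0 < 1 + s := by linarith
    -- If `v` were interior, `(1 + s) • v` would still have value at most `t`. Since `v` lies
    -- between it and `0`, where the value is below `t`, convexity would give a value below `t` at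
    -- `v`.
    have := hconv.2 (Set.mem_univ ((1 + s) • v)) (Set.mem_univ 0) (inv_nonneg.2 hpos.le)
      (show 0 ≤ s * (1 + s)⁻¹ by positivity) (by field_simp)
    simp only [smul_zero, add_zero, smul_smul, inv_mul_cancel₀ hpos.ne', one_smul,
      perturb_zero_right, smul_eq_mul, hv'] at this
    have h2 : t * (1 + s) ≤ (perturb ε X ((1 + s) • v)).lambdaMax + s * X.lambdaMax := by
      calc t * (1 + s) ≤ ((1 + s)⁻¹ * (perturb ε X ((1 + s) • v)).lambdaMax
            + s * (1 + s)⁻¹ * X.lambdaMax) * (1 + s) := by gcongr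
        _ = _ := by field_simp
    nlinarith

end SymMat

/-- Supplies the measurability of `φ φᵀ`: neither `i₀` nor `φ` is assumed measurable, but `φ φᵀ` is
almost surely the gradient of a jointly continuous function. -/
theorem measurable_fderiv_param_apply {α E : Type*} [TopologicalSpace α] [MeasurableSpace α]
    [OpensMeasurableSpace α] [NormedAddCommGroup E] [NormedSpace ℝ E] [FiniteDimensional ℝ E]
    [SecondCountableTopologyEither α E] {f : α → E → ℝ} (hf : Continuous f.uncurry) (x : E) :
    Measurable fun a => fderiv ℝ (f a) x := by
  borelize E
  have : LocallyCompactSpace E := inferInstance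
  exact (measurable_fderiv_with_param ℝ hf).comp measurable_prodMk_right

/-! ### The maximum of `k` perturbations: bounds and gradient. -/

namespace SymMat

variable {n k : ℕ}

theorem lambdaMax_perturb_le_maxPerturbed (ε : ℝ) (v : Fin k → EuclideanSpace ℝ (Fin n))
    (X : SymMat n) (i : Fin k) : (perturb ε X (v i)).lambdaMax ≤ maxPerturbed ε v X :=
  le_ciSup (f := fun i => (perturb ε X (v i)).lambdaMax) (Set.finite_range _).bddAbove i

theorem exists_maxPerturbed_eq (hk : 1 ≤ k) (ε : ℝ) (v : Fin k → EuclideanSpace ℝ (Fin n))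
    (X : SymMat n) : ∃ i, maxPerturbed ε v X = (perturb ε X (v i)).lambdaMax := by
  have : Nonempty (Fin k) := ⟨⟨0, hk⟩⟩
  obtain ⟨i, hi⟩ := exists_eq_ciSup_of_finite (f := fun i => (perturb ε X (v i)).lambdaMax)
  exact ⟨i, hi.symm⟩

theorem lipschitzWith_maxPerturbed (hn : 1 ≤ n) (hk : 1 ≤ k) (ε : ℝ)
    (v : Fin k → EuclideanSpace ℝ (Fin n)) : LipschitzWith 1 (maxPerturbed ε v) := by
  refine LipschitzWith.of_le_add fun A B => ?_
  obtain ⟨i, hi⟩ := exists_maxPerturbed_eq hk ε v A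
  have h1 := lambdaMax_perturb_le_maxPerturbed ε v B i
  have h2 := (lipschitzWith_lambdaMax hn).dist_le_mul (perturb ε A (v i)) (perturb ε B (v i))
  rw [perturb, perturb, dist_add_right, NNReal.coe_one, one_mul, Real.dist_eq] at h2
  have h3 := (le_abs_self _).trans h2
  rw [← perturb, ← perturb] at h3
  linarith

theorem continuous_maxPerturbed (hn : 1 ≤ n) (hk : 1 ≤ k) (ε : ℝ) :
    Continuous (Function.uncurry
      (maxPerturbed ε : (Fin k → EuclideanSpace ℝ (Fin n)) → SymMat n → ℝ)) := by
  have : Nonempty (Fin k) := ⟨⟨0, hk⟩⟩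
  have h : Function.uncurry (maxPerturbed ε : (Fin k → EuclideanSpace ℝ (Fin n)) → SymMat n → ℝ)
      = fun p => Finset.univ.sup' Finset.univ_nonempty
          fun i => (perturb ε p.2 (p.1 i)).lambdaMax := by
    funext p
    rw [Finset.sup'_univ_eq_ciSup]
    rfl
  rw [h]
  refine Continuous.finset_sup'_apply _ fun i _ => (lipschitzWith_lambdaMax hn).continuous.comp
    ((continuous_perturb ε).comp (continuous_snd.prodMk ((continuous_apply i).comp continuous_fst)))

theorem abs_lambdaMax_le (hn : 1 ≤ n) (A : SymMat n) : |A.lambdaMax| ≤ ‖A‖ := by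
  obtain ⟨v, hv⟩ := A.exists_isLeadingEigenvector hn
  obtain ⟨hv1, hvA⟩ := isLeadingEigenvector_iff.1 hv
  have h := abs_real_inner_le_norm (outer v) A
  rwa [norm_outer, hv1, hvA, one_pow, one_mul] at h

theorem abs_maxPerturbed_le (hn : 1 ≤ n) (hk : 1 ≤ k) (ε : ℝ)
    (v : Fin k → EuclideanSpace ℝ (Fin n)) (X : SymMat n) :
    |maxPerturbed ε v X| ≤ ‖X‖ + |ε / n| * ∑ i, ‖v i‖ ^ 2 := by
  obtain ⟨i, hi⟩ := exists_maxPerturbed_eq hk ε v X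
  rw [hi]
  refine (abs_lambdaMax_le hn _).trans ((norm_add_le _ _).trans ?_)
  rw [norm_smul, norm_outer, Real.norm_eq_abs]
  gcongr
  exact Finset.single_le_sum (f := fun i => ‖v i‖ ^ 2) (fun _ _ => by positivity)
    (Finset.mem_univ i)

/-- Gradient of the maximum at a point where the maximizing index is unique and the corresponding
leading eigenvector is unique up to sign. -/
theorem hasGradientAt_maxPerturbed (hn : 1 ≤ n) (hk : 1 ≤ k) (ε : ℝ)
    (v : Fin k → EuclideanSpace ℝ (Fin n)) (X : SymMat n) {i₀ : Fin k}
    {φ : EuclideanSpace ℝ (Fin n)}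
    (hi₀ : ∀ i, i ≠ i₀ → (perturb ε X (v i)).lambdaMax < (perturb ε X (v i₀)).lambdaMax)
    (hφ : ∀ ψ, (perturb ε X (v i₀)).IsLeadingEigenvector ψ → ψ = φ ∨ ψ = -φ) :
    HasGradientAt (maxPerturbed ε v) (outer φ) X := by
  have hform : ∀ (Y : SymMat n) (x : Fin k × Metric.sphere (0 : EuclideanSpace ℝ (Fin n)) 1),
      inner ℝ (outer x.2.1) Y + ε / n * inner ℝ x.2.1 (v x.1) ^ 2
        = inner ℝ (outer x.2.1) (perturb ε Y (v x.1)) := fun Y x =>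
    (inner_outer_perturb ε Y _ _).symm
  have hle : ∀ (Y : SymMat n) (x : Fin k × Metric.sphere (0 : EuclideanSpace ℝ (Fin n)) 1),
      inner ℝ (outer x.2.1) (perturb ε Y (v x.1)) ≤ (perturb ε Y (v x.1)).lambdaMax := by
    intro Y x
    have := (perturb ε Y (v x.1)).inner_outer_le x.2.1
    rwa [mem_sphere_zero_iff_norm.1 x.2.2, one_pow, mul_one] at this
  refine hasGradientAt_of_affine_max
    (K := Fin k × Metric.sphere (0 : EuclideanSpace ℝ (Fin n)) 1)
    (a := fun x => outer x.2.1) (b := fun x => ε / n * inner ℝ x.2.1 (v x.1) ^ 2)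
    (continuous_outer.comp (continuous_subtype_val.comp continuous_snd)) ?_ ?_ ?_ ?_
  · have : Continuous v := continuous_of_discreteTopology
    fun_prop
  · intro Y x
    rw [hform]
    exact (hle Y x).trans (lambdaMax_perturb_le_maxPerturbed ε v Y x.1)
  · intro Y
    obtain ⟨i, hi⟩ := exists_maxPerturbed_eq hk ε v Y
    obtain ⟨u, hu⟩ := (perturb ε Y (v i)).exists_isLeadingEigenvector hn
    refine ⟨(i, ⟨u, mem_sphere_zero_iff_norm.2 hu.1⟩), ?_⟩
    rw [hform, hi]
    exact (isLeadingEigenvector_iff.1 hu).2.symm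
  -- A maximizing pair makes every inequality an equality, so its index is `i₀` and its vector is
  -- leading; the sign disappears in the outer product.
  · intro x hx
    rw [hform] at hx
    have h1 := hle X x
    have h2 := lambdaMax_perturb_le_maxPerturbed ε v X i₀
    have h3 := lambdaMax_perturb_le_maxPerturbed ε v X x.1
    have hxi : x.1 = i₀ := by
      by_contra hne
      have := hi₀ x.1 hne
      linarith
    have hlead : (perturb ε X (v x.1)).IsLeadingEigenvector x.2.1 :=
      isLeadingEigenvector_iff.2 ⟨mem_sphere_zero_iff_norm.1 x.2.2, by linarith⟩
    rw [hxi] at hlead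
    rcases hφ _ hlead with h | h
    · exact congrArg outer h
    · exact (congrArg outer h).trans (outer_neg φ)

/-! ### Absence of ties, integrability and differentiation under the expectation. -/

section Random

variable {Ω : Type*} [MeasurableSpace Ω] {P : Measure Ω}
  {z : Fin k → Ω → EuclideanSpace ℝ (Fin n)}

theorem ae_lambdaMax_perturb_ne [IsProbabilityMeasure P] {ε : ℝ} (hn : 1 ≤ n) (hε : 0 < ε)
    (hz : ∀ i, HasLaw (z i) (stdGaussian (EuclideanSpace ℝ (Fin n))) P)
    (hindep : iIndepFun z P) (X : SymMat n) :
    ∀ᵐ ω ∂P, ∀ i j, i ≠ j →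
      (perturb ε X (z i ω)).lambdaMax ≠ (perturb ε X (z j ω)).lambdaMax := by
  rw [ae_all_iff]; intro i
  rw [ae_all_iff]; intro j
  by_cases hij : i = j
  · exact Filter.Eventually.of_forall fun _ h => absurd hij h
  have hlaw := (indepFun_iff_map_prod_eq_prod_map_map (hz i).aemeasurable
    (hz j).aemeasurable).1 (hindep.indepFun hij)
  rw [(hz i).map_eq, (hz j).map_eq] at hlaw
  have hf := continuous_lambdaMax_perturb hn ε X
  have hmeas : MeasurableSet {p : EuclideanSpace ℝ (Fin n) × EuclideanSpace ℝ (Fin n) |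
      (perturb ε X p.1).lambdaMax = (perturb ε X p.2).lambdaMax} :=
    (isClosed_eq (hf.comp continuous_fst) (hf.comp continuous_snd)).measurableSet
  -- By Fubini, for each fixed first vector a tie forces the second into a null level set.
  have hnull := (Measure.measure_prod_null (μ := stdGaussian (EuclideanSpace ℝ (Fin n)))
    (ν := stdGaussian (EuclideanSpace ℝ (Fin n))) hmeas).2
    (Filter.Eventually.of_forall fun a => by
      simp only [Set.preimage_ofPred_eq, eq_comm (a := (perturb ε X a).lambdaMax)]
      exact stdGaussian_lambdaMax_perturb_eq hn hε X (perturb ε X a).lambdaMax)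
  rw [← hlaw, measure_eq_zero_iff_ae_notMem] at hnull
  filter_upwards [ae_of_ae_map ((hz i).aemeasurable.prodMk (hz j).aemeasurable) hnull]
    with ω hω _ h using hω h

theorem aemeasurable_family (hz : ∀ i, HasLaw (z i) (stdGaussian (EuclideanSpace ℝ (Fin n))) P) :
    AEMeasurable (fun ω i => z i ω) P :=
  aemeasurable_pi_iff.2 fun i => (hz i).aemeasurable

theorem integrable_maxPerturbed [IsProbabilityMeasure P] (hn : 1 ≤ n) (hk : 1 ≤ k) (ε : ℝ)
    (hz : ∀ i, HasLaw (z i) (stdGaussian (EuclideanSpace ℝ (Fin n))) P) (Y : SymMat n) :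
    Integrable (fun ω => maxPerturbed ε (fun i => z i ω) Y) P := by
  have hcont : Continuous fun v : Fin k → EuclideanSpace ℝ (Fin n) => maxPerturbed ε v Y :=
    Continuous.uncurry_right (f := maxPerturbed ε) Y (continuous_maxPerturbed hn hk ε)
  have hint : ∀ i, Integrable (fun ω => ‖z i ω‖ ^ 2) P := fun i => by
    have h := IsGaussian.memLp_id (stdGaussian (EuclideanSpace ℝ (Fin n))) 2 (by simp)
    rw [← (hz i).map_eq] at h
    exact (h.comp_of_map (hz i).aemeasurable).integrable_norm_pow two_ne_zero
  refine Integrable.mono' ((integrable_const ‖Y‖).add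
    ((integrable_finsetSum Finset.univ fun i _ => hint i).const_mul |ε / n|))
    (hcont.measurable.comp_aemeasurable (aemeasurable_family hz)).aestronglyMeasurable
    (Filter.Eventually.of_forall fun ω => ?_)
  exact abs_maxPerturbed_le hn hk ε (fun i => z i ω) Y

/-- Differentiation under the expectation. -/
theorem integrable_and_hasGradientAt_smoothed [IsProbabilityMeasure P] (hn : 1 ≤ n) (hk : 1 ≤ k)
    (ε : ℝ) (hz : ∀ i, HasLaw (z i) (stdGaussian (EuclideanSpace ℝ (Fin n))) P) {X : SymMat n}
    {G : Ω → SymMat n}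
    (hG : ∀ᵐ ω ∂P, HasGradientAt (maxPerturbed ε fun i => z i ω) (G ω) X) :
    Integrable G P ∧ HasGradientAt (smoothed P ε z) (∫ ω, G ω ∂P) X := by
  have hmeas : Measurable fun v : Fin k → EuclideanSpace ℝ (Fin n) =>
      fderiv ℝ (maxPerturbed ε v) X :=
    measurable_fderiv_param_apply (continuous_maxPerturbed hn hk ε) X
  -- `G` is not assumed measurable; it inherits measurability from the derivative it represents
  -- almost everywhere.
  have hF' : AEStronglyMeasurable (fun ω => innerSL ℝ (G ω)) P := by
    refine (hmeas.comp_aemeasurable (aemeasurable_family hz)).aestronglyMeasurable.congr ?_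
    filter_upwards [hG] with ω hω using hω.hasFDerivAt.fderiv
  obtain ⟨h1, h2⟩ := hasFDerivAt_integral_of_dominated_loc_of_lip (𝕜 := ℝ) (μ := P)
    (F := fun Y ω => maxPerturbed ε (fun i => z i ω) Y) (F' := fun ω => innerSL ℝ (G ω))
    (bound := fun _ => 1) (x₀ := X) Filter.univ_mem
    (Filter.Eventually.of_forall fun Y => (integrable_maxPerturbed hn hk ε hz Y).1)
    (integrable_maxPerturbed hn hk ε hz X) hF'
    (Filter.Eventually.of_forall fun ω => by
      simpa using lipschitzWith_maxPerturbed hn hk ε fun i => z i ω)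
    (integrable_const 1) (hG.mono fun ω hω => hω.hasFDerivAt)
  have hGint : Integrable G P := by
    have := ((InnerProductSpace.toDual ℝ
      (SymMat n)).symm.toContinuousLinearEquiv.toContinuousLinearMap).integrable_comp h1
    refine this.congr (Filter.Eventually.of_forall fun ω => ?_)
    exact (InnerProductSpace.toDual ℝ (SymMat n)).symm_apply_apply (G ω)
  refine ⟨hGint, ?_⟩
  rw [ContinuousLinearMap.integral_comp_comm (innerSL ℝ) hGint] at h2
  exact h2

end Random

/-! ### Trace, variance and the main theorem. -/

/-- The identity matrix. -/
def identity (n : ℕ) : SymMat n := ⟨1, Matrix.isSymm_one⟩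

theorem trace_eq_inner_identity (A : SymMat n) : A.mat.trace = inner ℝ (identity n) A := by
  rw [inner_eq_trace]
  change _ = ((1 : Matrix (Fin n) (Fin n) ℝ)ᵀ * A.mat).trace
  rw [Matrix.transpose_one, one_mul]

theorem trace_outer (v : EuclideanSpace ℝ (Fin n)) : (outer v).mat.trace = ‖v‖ ^ 2 := by
  change (Matrix.vecMulVec (WithLp.ofLp v) (WithLp.ofLp v)).trace = _
  rw [Matrix.trace_vecMulVec, EuclideanSpace.real_norm_sq_eq]
  simp [dotProduct, sq]

theorem norm_sq_eq_trace_sq (A : SymMat n) : ‖A‖ ^ 2 = (A.mat ^ 2).trace := by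
  rw [← real_inner_self_eq_norm_sq, inner_eq_trace, A.mat_isSymm.eq, sq]

end SymMat

theorem integral_norm_sub_integral_sq {E Ω : Type*} [NormedAddCommGroup E] [InnerProductSpace ℝ E]
    [CompleteSpace E] [MeasurableSpace Ω] {P : Measure Ω} [IsProbabilityMeasure P] {M : Ω → E}
    (hM : Integrable M P) (hM1 : ∀ᵐ ω ∂P, ‖M ω‖ = 1) :
    Integrable (fun ω => ‖M ω - ∫ ω, M ω ∂P‖ ^ 2) P ∧
      ∫ ω, ‖M ω - ∫ ω, M ω ∂P‖ ^ 2 ∂P = 1 - ‖∫ ω, M ω ∂P‖ ^ 2 := by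
  set m := ∫ ω, M ω ∂P with hm
  have hae : (fun ω => 1 - 2 * inner ℝ m (M ω) + ‖m‖ ^ 2) =ᵐ[P] fun ω => ‖M ω - m‖ ^ 2 := by
    filter_upwards [hM1] with ω hω
    rw [norm_sub_sq_real, hω, real_inner_comm, one_pow]
  have hin : Integrable (fun ω => inner ℝ m (M ω)) P := hM.const_inner m
  have hint : Integrable (fun ω => 1 - 2 * inner ℝ m (M ω)) P :=
    (integrable_const 1).sub (hin.const_mul 2)
  refine ⟨(hint.add (integrable_const _)).congr hae, ?_⟩
  rw [← integral_congr_ae hae, integral_add hint (integrable_const _),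
    integral_sub (integrable_const 1) (hin.const_mul 2), integral_const_mul, integral_inner hM,
    ← hm, real_inner_self_eq_norm_sq]
  simp
  ring

theorem mainTheorem2 {n k : ℕ} (hn : 1 ≤ n) (hk : 1 ≤ k) {ε : ℝ} (hε : 0 < ε)
    {Ω : Type*} [MeasurableSpace Ω] (P : Measure Ω) [IsProbabilityMeasure P]
    (z : Fin k → Ω → EuclideanSpace ℝ (Fin n))
    (hz : ∀ i, HasLaw (z i) (stdGaussian (EuclideanSpace ℝ (Fin n))) P)
    (hindep : iIndepFun z P)
    (X : SymMat n)
    -- `i₀` attains the maximum, and `φ` is a leading eigenvector of the `i₀`-th matrix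
    (i₀ : Ω → Fin k) (φ : Ω → EuclideanSpace ℝ (Fin n))
    (hi₀ : ∀ᵐ ω ∂P, ∀ i, (SymMat.perturb ε X (z i ω)).lambdaMax
      ≤ (SymMat.perturb ε X (z (i₀ ω) ω)).lambdaMax)
    (hφ : ∀ᵐ ω ∂P, (SymMat.perturb ε X (z (i₀ ω) ω)).IsLeadingEigenvector (φ ω)) :
    -- almost surely the maximizer is unique, and the leading eigenvector is unique up to sign
    (∀ᵐ ω ∂P, ∀ i, i ≠ i₀ ω → (SymMat.perturb ε X (z i ω)).lambdaMax
      < (SymMat.perturb ε X (z (i₀ ω) ω)).lambdaMax) ∧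
    (∀ᵐ ω ∂P, ∀ ψ, (SymMat.perturb ε X (z (i₀ ω) ω)).IsLeadingEigenvector ψ →
      ψ = φ ω ∨ ψ = -φ ω) ∧
    -- the expectations exist, and the gradient is the expectation of `φ φᵀ`
    (∀ Y : SymMat n, Integrable (fun ω => SymMat.maxPerturbed ε (fun i => z i ω) Y) P) ∧
    Integrable (fun ω => SymMat.outer (φ ω)) P ∧
    HasGradientAt (SymMat.smoothed P ε z) (∫ ω, SymMat.outer (φ ω) ∂P) X ∧
    -- trace and variance
    (∇ (SymMat.smoothed P ε z) X).mat.trace = 1 ∧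
    Integrable
      (fun ω => ‖SymMat.outer (φ ω) - ∇ (SymMat.smoothed P ε z) X‖ ^ 2) P ∧
    ∫ ω, ‖SymMat.outer (φ ω) - ∇ (SymMat.smoothed P ε z) X‖ ^ 2 ∂P
      = 1 - ((∇ (SymMat.smoothed P ε z) X).mat ^ 2).trace ∧
    1 - ((∇ (SymMat.smoothed P ε z) X).mat ^ 2).trace ≤ 1 := by
  have hne := SymMat.ae_lambdaMax_perturb_ne hn hε hz hindep X
  have hlt : ∀ᵐ ω ∂P, ∀ i, X.lambdaMax < (SymMat.perturb ε X (z i ω)).lambdaMax :=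
    ae_all_iff.2 fun i => ae_of_ae_map (hz i).aemeasurable
      ((hz i).map_eq.symm ▸ SymMat.ae_lambdaMax_lt_perturb hn hε X)
  have huniq : ∀ᵐ ω ∂P, ∀ i, i ≠ i₀ ω → (SymMat.perturb ε X (z i ω)).lambdaMax
      < (SymMat.perturb ε X (z (i₀ ω) ω)).lambdaMax := by
    filter_upwards [hne, hi₀] with ω h1 h2 i hi using lt_of_le_of_ne (h2 i) (h1 i _ hi)
  have hsign : ∀ᵐ ω ∂P, ∀ ψ, (SymMat.perturb ε X (z (i₀ ω) ω)).IsLeadingEigenvector ψ →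
      ψ = φ ω ∨ ψ = -φ ω := by
    filter_upwards [hlt, hφ] with ω h1 h2 ψ hψ using h2.eq_or_eq_neg (h1 _) hψ
  have hgrad : ∀ᵐ ω ∂P,
      HasGradientAt (SymMat.maxPerturbed ε fun i => z i ω) (SymMat.outer (φ ω)) X := by
    filter_upwards [huniq, hsign] with ω h1 h2 using
      SymMat.hasGradientAt_maxPerturbed hn hk ε (fun i => z i ω) X h1 h2
  obtain ⟨hint, hF⟩ := SymMat.integrable_and_hasGradientAt_smoothed hn hk ε hz hgrad
  have hnorm : ∀ᵐ ω ∂P, ‖SymMat.outer (φ ω)‖ = 1 := by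
    filter_upwards [hφ] with ω h
    rw [SymMat.norm_outer, h.1, one_pow]
  obtain ⟨hvar_int, hvar⟩ := integral_norm_sub_integral_sq hint hnorm
  rw [hF.gradient]
  refine ⟨huniq, hsign, SymMat.integrable_maxPerturbed hn hk ε hz, hint, hF, ?_, hvar_int, ?_, ?_⟩
  -- The trace is the inner product with the identity, so it commutes with the expectation.
  · rw [SymMat.trace_eq_inner_identity, ← integral_inner hint]
    have : ∀ᵐ ω ∂P, inner ℝ (SymMat.identity n) (SymMat.outer (φ ω)) = 1 := by
      filter_upwards [hφ] with ω h
      rw [← SymMat.trace_eq_inner_identity, SymMat.trace_outer, h.1, one_pow]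
    rw [integral_congr_ae this]
    simp
  · rw [hvar, SymMat.norm_sq_eq_trace_sq]
  · rw [← SymMat.norm_sq_eq_trace_sq]
    linarith [sq_nonneg ‖∫ ω, SymMat.outer (φ ω) ∂P‖]
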